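/- Let $\mathbb K$ be an algebraically closed field of characteristic zero (for instance $\mathbb K=\mathbb C$), let $\mathfrak g$ be a finite-dimensional Lie algebra over $\mathbb K$, and let $\rho:\mathfrak g\to\mathrm{gl}(V)$ be a finite-dimensional representation. For $x\in V$ let $R_x:\mathfrak g\to V$, $R_x(\xi)=\rho(\xi)x$. Put $\dim\mathcal O_{\mathrm{reg}}=\max_{x\in V}\operatorname{rk}R_x$ and $q=\operatorname{codim}\mathcal O_{\mathrm{reg}}=\dim V-\dim\mathcal O_{\mathrm{reg}}$. A polynomial $f$ on $V$ is an invariant of $\rho$ if $df(x)(\rho(\xi)x)=0$ for all $x\in V$, $\xi\in\mathfrak g$. By Kronecker's theorem every pencil $A+\lambda B$ of linear maps between finite-dimensional spaces can be brought, by a choice of bases, to a block-diagonal form, unique up to permutation of blocks, whose blocks are Jordan blocks with finite or infinite eigenvalue, horizontal Kronecker blocks of size $\varepsilon_i\times(\varepsilon_i+1)$ and vertical Kronecker blocks of size $(\eta_j+1)\times\eta_j$ (with $\varepsilon_i,\eta_j\ge 0$; a zero $g\times h$ block is counted as $g$ vertical blocks of size $1\times 0$ and $h$ horizontal blocks of size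 $0\times 1$). The algebraic type of the pencil consists of the number of distinct eigenvalues, the sizes of the Jordan blocks for each of them, and the numbers $\varepsilon_i$ and $\eta_j$. There is a non-empty Zariski open subset of $V\times V$ on which the algebraic type of the pencil $R_x+\lambda R_a=R_{x+\lambda a}$ does not depend on $(x,a)$; let $\eta_1(\rho),\eta_2(\rho),\dots$ be the numbers $\eta_j$ of this generic type, and let $$\mathsf k_{\mathrm{vert}}(\rho)=\sum_j(\eta_j(\rho)+1)$$ be the total Kronecker $v$-index of $\rho$, i.e. the total number of rows in the vertical Kronecker blocks of a generic pencil. Let $f_1,\dots,f_q$ be algebraically independent invariant polynomials of $\rho$. Then $$\sum_{\alpha=1}^q\deg f_\alpha\ \ge\ \mathsf k_{\mathrm{vert}}(\rho).$$ -/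

import Mathlib

attribute [local instance 100] LieRing.ofAssociativeRing

namespace JordanKronecker

/-! ### Canonical form of a pencil of linear maps -/

/-- The blocks of the Kronecker canonical form of a pencil `A + t B`.
* `jordan μ n`: Jordan block of size `n + 1` with eigenvalue `μ`;
* `jordanInf n`: Jordan block of size `n + 1` with eigenvalue `∞`;
* `horizontal ε`: horizontal Kronecker block of size `ε × (ε + 1)`;
* `vertical η`: vertical Kronecker block of size `(η + 1) × η`.
A zero `g × h` block is the sum of `g` blocks `vertical 0` and `h` blocks `horizontal 0`. -/
inductive Block (K : Type*) where
  | jordan (μ : K) (n : ℕ) : Block K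
  | jordanInf (n : ℕ) : Block K
  | horizontal (ε : ℕ) : Block K
  | vertical (η : ℕ) : Block K

namespace Block

variable {K : Type*}

/-- Number of rows of a block. -/
def rows : Block K → ℕ
  | jordan _ n => n + 1
  | jordanInf n => n + 1
  | horizontal ε => ε
  | vertical η => η + 1

/-- Number of columns of a block. -/
def cols : Block K → ℕ
  | jordan _ n => n + 1
  | jordanInf n => n + 1
  | horizontal ε => ε + 1
  | vertical η => η

/-- The matrix with ones at the places `(i, i)` and zeros elsewhere. -/
def diagOnes (K : Type*) [Field K] (m n : ℕ) : Matrix (Fin m) (Fin n) K :=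
  Matrix.of fun i j => if (i : ℕ) = j then 1 else 0

/-- The matrix with ones at the places `(i, i + 1)` and zeros elsewhere. -/
def superOnes (K : Type*) [Field K] (m n : ℕ) : Matrix (Fin m) (Fin n) K :=
  Matrix.of fun i j => if (i : ℕ) + 1 = j then 1 else 0

/-- The matrix with ones at the places `(j + 1, j)` and zeros elsewhere. -/
def subOnes (K : Type*) [Field K] (m n : ℕ) : Matrix (Fin m) (Fin n) K :=
  Matrix.of fun i j => if (i : ℕ) = j + 1 then 1 else 0

/-- The constant part `A` of the block `A + t B`. -/
def matA [Field K] : (β : Block K) → Matrix (Fin β.rows) (Fin β.cols) K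
  | jordan μ n => μ • diagOnes K (n + 1) (n + 1) + superOnes K (n + 1) (n + 1)
  | jordanInf n => diagOnes K (n + 1) (n + 1)
  | horizontal ε => diagOnes K ε (ε + 1)
  | vertical η => diagOnes K (η + 1) η

/-- The linear part `B` of the block `A + t B`. -/
def matB [Field K] : (β : Block K) → Matrix (Fin β.rows) (Fin β.cols) K
  | jordan _ n => diagOnes K (n + 1) (n + 1)
  | jordanInf n => superOnes K (n + 1) (n + 1)
  | horizontal ε => superOnes K ε (ε + 1)
  | vertical η => subOnes K (η + 1) η

/-- Eigenvalue (a point of the projective line) and size of a Jordan block. -/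
def jordanData : Block K → Option (OnePoint K × ℕ)
  | jordan μ n => some ((μ : OnePoint K), n + 1)
  | jordanInf n => some (OnePoint.infty, n + 1)
  | horizontal _ => none
  | vertical _ => none

/-- The minimal column index contributed by a block: the number of rows of a horizontal block. -/
def columnIndex : Block K → Option ℕ
  | jordan _ _ => none
  | jordanInf _ => none
  | horizontal ε => some ε
  | vertical _ => none

/-- The minimal row index contributed by a block: the number of columns of a vertical block. -/
def rowIndex : Block K → Option ℕ
  | jordan _ _ => none
  | jordanInf _ => none
  | horizontal _ => none
  | vertical η => some η

end Block

section Pencils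

variable {K : Type*} [Field K]
variable {U V : Type*} [AddCommGroup U] [Module K U] [AddCommGroup V] [Module K V]

/-- The block-diagonal pencil with the given blocks is a canonical form of `A + t B`: in suitable
bases of `U` and `V` the matrices of `A` and `B` are block-diagonal with these blocks. -/
def IsCanonicalForm (A B : U →ₗ[K] V) {k : ℕ} (β : Fin k → Block K) : Prop :=
  ∃ (u : Module.Basis (Σ i, Fin (β i).cols) K U) (v : Module.Basis (Σ i, Fin (β i).rows) K V),
    LinearMap.toMatrix u v A = Matrix.blockDiagonal' (fun i => (β i).matA) ∧
    LinearMap.toMatrix u v B = Matrix.blockDiagonal' (fun i => (β i).matB)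

/-- The discrete invariants of a pencil: for every distinct eigenvalue (possibly `∞`) the multiset
of the sizes of its Jordan blocks (the eigenvalues themselves are forgotten), the minimal column
indices and the minimal row indices. -/
@[ext]
structure AlgebraicType where
  jordanSizes : Multiset (Multiset ℕ)
  columnIndices : Multiset ℕ
  rowIndices : Multiset ℕ

open Classical in
/-- The algebraic type of a block-diagonal pencil. -/
noncomputable def blocksType {k : ℕ} (β : Fin k → Block K) : AlgebraicType where
  jordanSizes :=
    let J : Multiset (OnePoint K × ℕ) :=
      (Multiset.map β Finset.univ.val).filterMap Block.jordanData
    (J.map Prod.fst).dedup.map fun e => (J.filter fun p => p.1 = e).map Prod.snd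
  columnIndices := (Multiset.map β Finset.univ.val).filterMap Block.columnIndex
  rowIndices := (Multiset.map β Finset.univ.val).filterMap Block.rowIndex

/-- The pencil `A + t B` has algebraic type `T`. -/
def HasAlgebraicType (A B : U →ₗ[K] V) (T : AlgebraicType) : Prop :=
  ∃ (k : ℕ) (β : Fin k → Block K), IsCanonicalForm A B β ∧ blocksType β = T

/-- The total Kronecker `v`-index `∑ (η_j + 1)`: the total number of rows in the vertical
Kronecker blocks. -/
def AlgebraicType.kVert (T : AlgebraicType) : ℕ :=
  (T.rowIndices.map fun η => η + 1).sum

end Pencils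

/-- A subset of a vector space is Zariski open if it is the complement of the set of common zeros
of a set of polynomials in linear functionals. -/
def IsZariskiOpen (K : Type*) [Field K] {W : Type*} [AddCommGroup W] [Module K W]
    (s : Set W) : Prop :=
  ∃ S : Set (MvPolynomial (Module.Dual K W) K),
    s = {w | ∃ p ∈ S, MvPolynomial.eval (fun φ : Module.Dual K W => φ w) p ≠ 0}

section Representations

variable {K : Type*} [Field K]
variable {𝔤 : Type*} [LieRing 𝔤] [LieAlgebra K 𝔤]
variable {V : Type*} [AddCommGroup V] [Module K V]

/-- The operator `R_x : 𝔤 → V`, `R_x ξ = ρ(ξ) x`. -/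
def R (ρ : 𝔤 →ₗ⁅K⁆ Module.End K V) (x : V) : 𝔤 →ₗ[K] V where
  toFun ξ := ρ ξ x
  map_add' ξ η := by simp
  map_smul' c ξ := by simp

/-- `dim 𝒪_reg = max_x rk R_x`, the dimension of a regular orbit. -/
noncomputable def dimRegularOrbit (ρ : 𝔤 →ₗ⁅K⁆ Module.End K V) : ℕ :=
  ⨆ x : V, Module.finrank K (LinearMap.range (R ρ x))

/-- `codim 𝒪_reg`. -/
noncomputable def codimRegularOrbit (ρ : 𝔤 →ₗ⁅K⁆ Module.End K V) : ℕ :=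
  Module.finrank K V - dimRegularOrbit ρ

/-- `T` is the algebraic type of a generic pencil `R_x + t R_a`: the type of all pencils given by
pairs `(x, a)` from some non-empty Zariski open subset of `V × V`. -/
def IsGenericType (ρ : 𝔤 →ₗ⁅K⁆ Module.End K V) (T : AlgebraicType) : Prop :=
  ∃ W : Set (V × V), IsZariskiOpen K W ∧ W.Nonempty ∧
    ∀ p ∈ W, HasAlgebraicType (R ρ p.1) (R ρ p.2) T

open Classical in
/-- The Jordan–Kronecker invariant of `ρ`: the algebraic type of a generic pencil `R_x + t R_a`.
For finite-dimensional `𝔤` and `V` over an algebraically closed field it exists and is unique (by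
Kronecker's theorem on pencils, and since there are only finitely many types for given dimensions),
so that the second branch is never used there. -/
noncomputable def jordanKroneckerInvariant (ρ : 𝔤 →ₗ⁅K⁆ Module.End K V) : AlgebraicType :=
  if h : ∃ T, IsGenericType ρ T then h.choose else ⟨0, 0, 0⟩

/-- The total Kronecker `v`-index `k_vert(ρ)` of a representation. -/
noncomputable def totalKroneckerVIndex (ρ : 𝔤 →ₗ⁅K⁆ Module.End K V) : ℕ :=
  (jordanKroneckerInvariant ρ).kVert

variable {ι : Type*} [Fintype ι]

/-- The differential `df(x) ∈ V*` at `x ∈ V` of a polynomial `f` on `V`, written in the linear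
coordinates of the basis `b`. -/
noncomputable def differential (b : Module.Basis ι K V) (f : MvPolynomial ι K) (x : V) :
    Module.Dual K V :=
  ∑ i, MvPolynomial.eval (fun j => b.repr x j) (MvPolynomial.pderiv i f) • b.coord i

/-- `f` is an invariant of `ρ`: `R_x^* (df(x)) = 0` for all `x ∈ V`. -/
def IsInvariant (ρ : 𝔤 →ₗ⁅K⁆ Module.End K V) (b : Module.Basis ι K V) (f : MvPolynomial ι K) :
    Prop :=
  ∀ x : V, (R ρ x).dualMap (differential b f x) = 0

end Representations

end JordanKronecker

/-! For fixed `x` and `a`, invariance makes each `df_α(x + ta)` a polynomial row vector in `t`, of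
degree less than `deg f_α`, annihilating the pencil `R_x + t R_a` from the left. In Kronecker form
such a vector vanishes on Jordan and horizontal blocks, and on a vertical block of index `η` it is a
multiple of `((-t)^η, …, -t, 1)`. A nonzero component on that block therefore has degree at least
`η`.

For generic `(x, a)` the pencil has the generic type, `R_x` has maximal rank, and the `q` covectors
`df_α(x)` are independent (Jacobian criterion). The rank bounds the number of vertical blocks above
by `q`. Since a solution at `t = 0` is determined by its last entries on the vertical blocks,
independence forces exactly `q` blocks and makes the matrix of these last entries invertible. A
nonzero term of its determinant matches every block with an invariant satisfying `η + 1 ≤ deg f_α`;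
summing gives the bound (`kVert_le_sum_of_kernel`). -/

namespace JordanKronecker

/-! ### The Jacobian criterion via extension of derivations -/

section Jacobian

open MvPolynomial

/-- Factor through `FractionRing A`: a localization is formally smooth, and so is an essentially
finitely generated field extension in characteristic zero. -/
theorem formallySmooth_of_injective {K A L : Type*} [Field K] [CharZero K] [CommRing A] [IsDomain A]
    [Field L] [Algebra K A] [Algebra K L] [Algebra A L] [IsScalarTower K A L]
    [FaithfulSMul A L] [Algebra.EssFiniteType K L] : Algebra.FormallySmooth A L := by
  let _ := FractionRing.liftAlgebra A L
  have := FractionRing.isScalarTower_liftAlgebra A L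
  have : IsScalarTower K (FractionRing A) L :=
    IsScalarTower.of_algebraMap_eq fun x => by
      rw [IsScalarTower.algebraMap_apply K A L, IsScalarTower.algebraMap_apply A (FractionRing A) L,
        ← IsScalarTower.algebraMap_apply K A (FractionRing A)]
  have : Algebra.EssFiniteType (FractionRing A) L := Algebra.EssFiniteType.of_comp K _ L
  have : CharZero (FractionRing A) := charZero_of_injective_algebraMap
    (algebraMap K (FractionRing A)).injective
  have : Algebra.FormallySmooth A (FractionRing A) :=
    .of_isLocalization (nonZeroDivisors A)
  exact .comp A (FractionRing A) L

theorem exists_section_of_formallySmooth {A L B : Type*} [CommRing A] [CommRing L] [CommRing B]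
    [Algebra A L] [Algebra.FormallySmooth A L] (g : A →+* B) (π : B →+* L)
    (hπ : Function.Surjective π) (hnil : IsNilpotent (RingHom.ker π))
    (h : ∀ a, π (g a) = algebraMap A L a) :
    ∃ s : L →+* B, (∀ x, π (s x) = x) ∧ ∀ a, s (algebraMap A L a) = g a := by
  let _ := g.toAlgebra
  let π' : B →ₐ[A] L := { π with commutes' := h }
  let s : L →ₐ[A] B := Algebra.FormallySmooth.liftOfSurjective (AlgHom.id A L) π' hπ hnil
  exact ⟨s, fun x => Algebra.FormallySmooth.liftOfSurjective_apply (AlgHom.id A L) π' hπ hnil x,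
    fun a => s.commutes a⟩

/-- In characteristic zero the values of a derivation may be prescribed on algebraically
independent elements. -/
theorem exists_derivation_of_algebraicIndependent {K L κ : Type*} [Field K] [CharZero K] [Field L]
    [Algebra K L] [Algebra.EssFiniteType K L] {f : κ → L} (hf : AlgebraicIndependent K f)
    (c : κ → L) : ∃ D : Derivation K L L, ∀ β, D (f β) = c β := by
  let A := MvPolynomial κ K
  let _ : Algebra A L := (aeval f : A →ₐ[K] L).toAlgebra
  have : IsScalarTower K A L := IsScalarTower.of_algebraMap_eq fun x =>
    ((aeval f : A →ₐ[K] L).commutes x).symm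
  have : FaithfulSMul A L := (faithfulSMul_iff_algebraMap_injective A L).2 hf
  have : Algebra.FormallySmooth A L := formallySmooth_of_injective (K := K)
  -- A derivation is the `ε`-part of a ring section of `L[ε] → L`. The prescription `f β ↦ f β + c β
  -- ε` extends from `A` to such a section by formal smoothness.
  let g : A →ₐ[K] TrivSqZeroExt L L :=
    aeval fun β => TrivSqZeroExt.inl (f β) + TrivSqZeroExt.inr (c β)
  have hgX : ∀ β, g (X β) = TrivSqZeroExt.inl (f β) + TrivSqZeroExt.inr (c β) :=
    fun β => aeval_X _ β
  let π : TrivSqZeroExt L L →ₐ[K] L := TrivSqZeroExt.fstHom K L L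
  have hfst : ∀ a : A, π (g a) = algebraMap A L a := by
    intro a
    have : π.comp g = aeval f := by
      ext β
      simp [hgX, π]
    exact DFunLike.congr_fun this a
  have hnil : IsNilpotent (RingHom.ker (π : TrivSqZeroExt L L →+* L)) := by
    refine ⟨2, (sq (RingHom.ker (π : TrivSqZeroExt L L →+* L))).trans ?_⟩
    refine eq_bot_iff.2 (Ideal.mul_le.2 ?_)
    intro r hr s hs
    have hr' : r.fst = 0 := hr
    have hs' : s.fst = 0 := hs
    rw [Ideal.mem_bot]
    ext <;> simp [hr', hs']
  obtain ⟨s, hs, hsg⟩ := exists_section_of_formallySmooth (A := A) (L := L) g.toRingHom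
    (π : TrivSqZeroExt L L →+* L) (fun x => ⟨TrivSqZeroExt.inl x, rfl⟩) hnil hfst
  have hs' : ∀ x, (s x).fst = x := hs
  have hsK : ∀ k : K, s (algebraMap K L k) = TrivSqZeroExt.inl (algebraMap K L k) := by
    intro k
    rw [IsScalarTower.algebraMap_apply K A L, hsg, ← IsScalarTower.algebraMap_apply K A L]
    exact g.commutes k
  let D₀ : L →ₗ[K] L :=
    { toFun := fun x => (s x).snd
      map_add' := fun x y => by simp
      map_smul' := fun k x => by
        rw [Algebra.smul_def, map_mul, hsK]
        simp [Algebra.smul_def] }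
  have hD₀ : ∀ x, D₀ x = (s x).snd := fun _ => rfl
  refine ⟨Derivation.mk' D₀ fun x y => ?_, fun β => ?_⟩
  · simp only [hD₀, map_mul, TrivSqZeroExt.snd_mul, hs']
    simp [mul_comm]
  · change (s (f β)).snd = c β
    have h1 : f β = algebraMap A L (X β) := (aeval_X f β).symm
    have h2 : s (algebraMap A L (X β)) = g (X β) := hsg (X β)
    rw [h1, h2, hgX]
    simp only [TrivSqZeroExt.snd_add, TrivSqZeroExt.snd_inl, TrivSqZeroExt.snd_inr, zero_add]

theorem derivation_eq_sum_pderiv {K ι M : Type*} [CommRing K] [Fintype ι] [AddCommGroup M]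
    [Module K M] [Module (MvPolynomial ι K) M] [IsScalarTower K (MvPolynomial ι K) M]
    (D : Derivation K (MvPolynomial ι K) M) (p : MvPolynomial ι K) :
    D p = ∑ i, pderiv i p • D (X i) := by
  classical
  induction p using MvPolynomial.induction_on with
  | C a => simp
  | add p q hp hq => simp [hp, hq, add_smul, Finset.sum_add_distrib]
  | mul_X p j hp =>
    simp only [Derivation.leibniz, hp, add_smul, Finset.sum_add_distrib, pderiv_X,
      smul_eq_mul, mul_smul, Finset.smul_sum]
    simp [Pi.single_apply]

/-- The Jacobian criterion in characteristic zero: the Jacobian matrix of algebraically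
independent polynomials has a right inverse up to a nonzero factor. -/
theorem exists_jacobian_mul_eq {K ι κ : Type*} [Field K] [CharZero K] [Fintype ι] [Finite κ]
    [DecidableEq κ] {f : κ → MvPolynomial ι K} (hf : AlgebraicIndependent K f) :
    ∃ (d : MvPolynomial ι K) (N : ι → κ → MvPolynomial ι K), d ≠ 0 ∧
      ∀ α β, ∑ i, pderiv i (f α) * N i β = if α = β then d else 0 := by
  let P := MvPolynomial ι K
  let L := FractionRing P
  have hinj : Function.Injective (algebraMap P L) := IsFractionRing.injective P L
  have : Algebra.EssFiniteType P L := .of_isLocalization L (nonZeroDivisors P)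
  have : Algebra.EssFiniteType K L := Algebra.EssFiniteType.comp K P L
  have hf' : AlgebraicIndependent K fun β => algebraMap P L (f β) :=
    AlgebraicIndependent.map' (f := IsScalarTower.toAlgHom K P L) hf hinj
  -- The `D β` are dual to the `f α`; expanding `D β (f α)` by the chain rule exhibits a right
  -- inverse of the Jacobian over `L`, whose denominators `d` then clears.
  choose D hD using fun β : κ => exists_derivation_of_algebraicIndependent hf'
    (fun α => if α = β then 1 else 0)
  have key : ∀ (β : κ) (p : P), D β (algebraMap P L p) =
      ∑ i, algebraMap P L (pderiv i p) * D β (algebraMap P L (X i)) := by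
    intro β p
    refine (derivation_eq_sum_pderiv ((D β).compAlgebraMap P) p).trans ?_
    exact Finset.sum_congr rfl fun i _ => Algebra.smul_def _ _
  obtain ⟨d, hd⟩ := IsLocalization.exist_integer_multiples_of_finite (nonZeroDivisors P)
    fun x : ι × κ => D x.2 (algebraMap P L (X x.1))
  choose N hN using hd
  refine ⟨d, fun i β => N (i, β), nonZeroDivisors.ne_zero d.2, fun α β => hinj ?_⟩
  have h1 := key β (f α)
  rw [hD β α] at h1
  simp only [map_sum, map_mul, hN, Algebra.smul_def]
  calc _ = algebraMap P L d * ∑ i, algebraMap P L (pderiv i (f α)) *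
        D β (algebraMap P L (X i)) := by
        rw [Finset.mul_sum]
        exact Finset.sum_congr rfl fun i _ => by ring
    _ = _ := by
        rw [← h1]
        split_ifs <;> simp

end Jacobian

/-! ### Left polynomial kernels of single Kronecker blocks -/

section Block

open Polynomial

variable {K : Type*} [Field K]

/-- The entries of the pencil `A + X B` given by a block. -/
noncomputable def Block.pencil (β : Block K) (r : Fin β.rows) (c : Fin β.cols) : K[X] :=
  C (β.matA r c) + X * C (β.matB r c)

/-- Column `i` involves only `p i` and its predecessor, so the entries vanish successively, `a`
being a non-zero-divisor. -/
theorem eq_zero_of_bidiagonal {m : ℕ} {p : Fin m → K[X]} {a b : K[X]} (ha : a ≠ 0)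
    (h : ∀ i : Fin m, ∑ r : Fin m, p r * ((if (r : ℕ) = i then a else 0) +
      if (r : ℕ) + 1 = i then b else 0) = 0) :
    p = 0 := by
  have key : ∀ (n : ℕ) (hn : n < m), p ⟨n, hn⟩ = 0 := by
    intro n
    induction n using Nat.strong_induction_on with
    | _ n ih =>
      intro hn
      have := h ⟨n, hn⟩
      rw [Finset.sum_eq_single ⟨n, hn⟩] at this
      · simpa [ha] using this
      · intro r _ hr
        by_cases hr' : (r : ℕ) < n
        · rw [show p r = 0 from ih r hr' r.2, zero_mul]
        · have hne : (r : ℕ) ≠ n := fun h' => hr (Fin.ext h')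
          rw [if_neg hne, if_neg (by simp only; omega), add_zero, mul_zero]
      · simp
  ext1 i
  exact key i i.2

theorem Block.eq_zero_of_rowIndex_eq_none {β : Block K} (hβ : β.rowIndex = none)
    {p : Fin β.rows → K[X]} (h : ∀ c, ∑ r, p r * β.pencil r c = 0) : p = 0 := by
  cases β with
  | jordan μ n =>
    refine eq_zero_of_bidiagonal (m := n + 1) (a := X + C μ) (b := 1)
      (X_add_C_ne_zero μ) fun i => Eq.trans (Finset.sum_congr rfl fun r _ => ?_) (h i)
    have hr : (jordan μ n).pencil r i = C (μ * (if (r : ℕ) = i then (1 : K) else 0) +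
      if (r : ℕ) + 1 = i then (1 : K) else 0) + X * C (if (r : ℕ) = i then (1 : K) else 0) := rfl
    rw [hr]
    split_ifs <;> simp <;> ring_nf <;> simp
  | jordanInf n =>
    refine eq_zero_of_bidiagonal (m := n + 1) (a := 1) (b := X) one_ne_zero
      fun i => Eq.trans (Finset.sum_congr rfl fun r _ => ?_) (h i)
    have hr : (jordanInf n).pencil r i = C (if (r : ℕ) = i then (1 : K) else 0) +
      X * C (if (r : ℕ) + 1 = i then (1 : K) else 0) := rfl
    rw [hr]
    split_ifs <;> simp
  | horizontal ε =>
    refine eq_zero_of_bidiagonal (m := ε) (a := 1) (b := X) one_ne_zero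
      -- Omitting the last column leaves a square bidiagonal block with unit diagonal.
      fun i => Eq.trans (Finset.sum_congr rfl fun r _ => ?_) (h i.castSucc)
    have hr : (horizontal ε).pencil r i.castSucc = C (if (r : ℕ) = i then (1 : K) else 0) +
      X * C (if (r : ℕ) + 1 = i then (1 : K) else 0) := rfl
    rw [hr]
    split_ifs <;> simp
  | vertical η => simp [rowIndex] at hβ

omit [Field K] in
theorem Block.rows_eq_of_rowIndex_eq_some {β : Block K} {η : ℕ} (hβ : β.rowIndex = some η) :
    β.rows = η + 1 := by
  cases β <;> simp_all [rowIndex, rows]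

theorem Block.matA_last {β : Block K} {η : ℕ} (hβ : β.rowIndex = some η) {r : Fin β.rows}
    (hr : (r : ℕ) = η) (c : Fin β.cols) : β.matA r c = 0 := by
  cases β with
  | vertical η' =>
    obtain rfl : η' = η := by simpa [rowIndex] using hβ
    have := c.2
    simp only [cols] at this
    simp only [matA, diagOnes]
    exact if_neg (by omega)
  | _ => simp [rowIndex] at hβ

/-- Polynomial row vectors annihilated by a vertical block are multiples of
`((-X)^η, …, -X, 1)`. -/
theorem Block.eq_pow_mul_last {β : Block K} {η : ℕ} (hβ : β.rowIndex = some η)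
    {p : Fin β.rows → K[X]} (h : ∀ c, ∑ r, p r * β.pencil r c = 0) {s : Fin β.rows}
    (hs : (s : ℕ) = η) (r : Fin β.rows) : p r = (-X) ^ (η - (r : ℕ)) * p s := by
  cases β with
  | vertical η' =>
    obtain rfl : η' = η := by simpa [rowIndex] using hβ
    -- Column `i` of a vertical block has only the entries `1` in row `i` and `X` in row `i + 1`.
    have hstep : ∀ (i : ℕ) (hi : i < η'), p ⟨i, by simp only [rows]; omega⟩ =
        -X * p ⟨i + 1, by simp only [rows]; omega⟩ := by
      intro i hi
      have h1 := h ⟨i, hi⟩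
      have hr : ∀ r : Fin (η' + 1), (vertical η').pencil r ⟨i, hi⟩ =
          C (if (r : ℕ) = i then (1 : K) else 0) + X * C (if (r : ℕ) = i + 1 then (1 : K) else 0) :=
        fun _ => rfl
      have h2 := (Fintype.sum_eq_add (α := Fin (η' + 1))
        (f := fun r => p r * (vertical η').pencil r ⟨i, hi⟩) ⟨i, by omega⟩ ⟨i + 1, by omega⟩
        (by simp) fun r hr' => by
          simp only [hr, if_neg fun e => hr'.1 (Fin.ext e), if_neg fun e => hr'.2 (Fin.ext e)]
          simp).symm.trans h1
      simp only [hr] at h2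
      simp at h2
      exact (eq_neg_of_add_eq_zero_left h2).trans (by rw [neg_mul, mul_comm]; rfl)
    have key : ∀ (m i : ℕ) (hi : i + m = η'), p ⟨i, by simp only [rows]; omega⟩ =
        (-X) ^ m * p s := by
      intro m
      induction m with
      | zero =>
        intro i hi
        have : s = ⟨i, by simp only [rows]; omega⟩ := Fin.ext (by simp only; omega)
        rw [this]
        simp
      | succ m ih =>
        intro i hi
        rw [hstep i (by omega), ih (i + 1) (by omega)]
        ring
    have hr : (r : ℕ) < η' + 1 := r.2
    exact key (η' - r) r (by omega)
  | _ => simp [rowIndex] at hβ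

omit [Field K] in
theorem kVert_blocksType {k : ℕ} (β : Fin k → Block K) :
    (blocksType β).kVert =
      ∑ i : {i // (β i).rowIndex.isSome}, (((β i).rowIndex.get i.2) + 1) := by
  have h1 : ∀ s : Multiset (Block K), ((s.filterMap Block.rowIndex).map fun η => η + 1).sum =
      (s.map fun B => B.rowIndex.elim 0 fun η => η + 1).sum := by
    intro s
    induction s using Multiset.induction_on with
    | empty => simp
    | cons B s ih =>
      cases hB : B.rowIndex with
      | none => simp [Multiset.filterMap_cons_none _ _ hB, ih, hB]
      | some η => simp [Multiset.filterMap_cons_some _ _ _ hB, ih, hB]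
  have h2 : (blocksType β).kVert = ∑ i, (β i).rowIndex.elim 0 fun η => η + 1 := by
    simp only [AlgebraicType.kVert, blocksType, h1, Multiset.map_map]
    rfl
  rw [h2]
  symm
  refine Finset.sum_of_injOn Subtype.val (Subtype.val_injective.injOn) (by simp) ?_ ?_
  · intro i _ hi
    have : (β i).rowIndex = none := by
      by_contra hne
      exact hi ⟨⟨i, Option.isSome_iff_ne_none.2 hne⟩, by simp, rfl⟩
    simp [this]
  · rintro ⟨i, hi⟩ _
    obtain ⟨η, hη⟩ := Option.isSome_iff_exists.1 hi
    simp [hη]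

end Block

/-! ### Degree bounds -/

section Degree

open MvPolynomial

theorem natDegree_aeval_le_totalDegree {K ι : Type*} [CommRing K] (c : ι → Polynomial K)
    (hc : ∀ i, (c i).natDegree ≤ 1) (p : MvPolynomial ι K) :
    (aeval c p).natDegree ≤ p.totalDegree := by
  have := aeval_natDegree_le p le_rfl c hc
  rwa [mul_one] at this

/-- A monomial `m` of the derivative comes from `m + e_i` in `p`. The strictness accounts for the `+
1` in each `η_j + 1`. -/
theorem totalDegree_pderiv_lt {K ι : Type*} [CommRing K] {p : MvPolynomial ι K} {i : ι}
    (h : pderiv i p ≠ 0) : (pderiv i p).totalDegree < p.totalDegree := by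
  obtain ⟨m, hm, hm'⟩ := Finset.exists_mem_eq_sup (pderiv i p).support
    (support_nonempty.2 h) fun s => s.sum fun _ e => e
  rw [totalDegree, hm']
  rw [mem_support_iff, coeff_pderiv] at hm
  have h1 := le_totalDegree (mem_support_iff.2 (left_ne_zero_of_mul hm))
  rw [Finsupp.sum_add_index' (by simp) (by simp), Finsupp.sum_single_index rfl] at h1
  exact h1

end Degree

/-! ### Genericity expressed by nonvanishing polynomials -/

section Generic

open MvPolynomial

variable {K : Type*} [Field K] {V : Type*} [AddCommGroup V] [Module K V]
  {ι : Type*} [Fintype ι]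

/-- A linear functional as a polynomial in the coordinates of a basis. -/
noncomputable def linearForm (b : Module.Basis ι K V) (φ : Module.Dual K V) : MvPolynomial ι K :=
  ∑ i, C (φ (b i)) * X i

theorem eval_linearForm (b : Module.Basis ι K V) (φ : Module.Dual K V) (x : V) :
    eval (fun i => b.repr x i) (linearForm b φ) = φ x := by
  conv_rhs => rw [← b.sum_repr x, map_sum]
  simp only [linearForm, map_sum, map_mul, eval_C, eval_X, map_smul, smul_eq_mul, mul_comm]

theorem exists_eval_ne_zero [Infinite K] (b : Module.Basis ι K V) {p : MvPolynomial ι K}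
    (hp : p ≠ 0) : ∃ x : V, eval (fun i => b.repr x i) p ≠ 0 := by
  by_contra! h
  refine hp (MvPolynomial.funext fun c => ?_)
  have := h (∑ i, c i • b i)
  simpa only [b.repr_sum_self, map_zero] using this

/-- A nonempty Zariski open subset of `V × V` contains, for some `a`, all `(x, a)` outside of a
hypersurface. -/
theorem IsZariskiOpen.exists_polynomial {W : Set (V × V)} (hW : IsZariskiOpen K W)
    (hne : W.Nonempty) (b : Module.Basis ι K V) : ∃ (a : V) (p : MvPolynomial ι K), p ≠ 0 ∧
      ∀ x, eval (fun i => b.repr x i) p ≠ 0 → (x, a) ∈ W := by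
  obtain ⟨S, rfl⟩ := hW
  obtain ⟨⟨x₀, a⟩, P, hP, hP₀⟩ := hne
  -- Restriction of `P` to the slice `V × {a}`, using `φ (x, a) = φ (x, 0) + φ (0, a)`.
  let p : MvPolynomial ι K := aeval (fun φ : Module.Dual K (V × V) =>
    linearForm b (φ ∘ₗ LinearMap.inl K V V) + C (φ (0, a))) P
  have hp : ∀ x, eval (fun i => b.repr x i) p =
      eval (fun φ : Module.Dual K (V × V) => φ (x, a)) P := by
    intro x
    have : (fun φ : Module.Dual K (V × V) => φ (x, a)) = fun φ => eval (fun i => b.repr x i)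
        (linearForm b (φ ∘ₗ LinearMap.inl K V V) + C (φ (0, a))) := by
      funext φ
      rw [map_add, eval_linearForm, eval_C, LinearMap.comp_apply, LinearMap.inl_apply, ← map_add]
      simp
    rw [this]
    exact eval₂Hom_bind₁ _ _ _ _
  refine ⟨a, p, fun h => hP₀ ?_, fun x hx => ⟨P, hP, by rwa [← hp]⟩⟩
  rw [← hp, h, map_zero]

/-- Lower semicontinuity of rank: `p` is a minor of `T x` of size the rank of `T x₀`, taken after a
projection onto the range of `T x₀` and equal to `1` at `x₀`. -/
theorem exists_polynomial_le_finrank_range {U : Type*} [AddCommGroup U] [Module K U]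
    [FiniteDimensional K V] (T : V →ₗ[K] U →ₗ[K] V) (b : Module.Basis ι K V) (x₀ : V) :
    ∃ p : MvPolynomial ι K, p ≠ 0 ∧ ∀ x, eval (fun i => b.repr x i) p ≠ 0 →
      Module.finrank K (LinearMap.range (T x₀)) ≤ Module.finrank K (LinearMap.range (T x)) := by
  classical
  set r := Module.finrank K (LinearMap.range (T x₀))
  let e := Module.finBasis K (LinearMap.range (T x₀))
  obtain ⟨π, hπ⟩ := (LinearMap.range (T x₀)).subtype.exists_leftInverse_of_injective
    (Submodule.ker_subtype _)
  choose ξ hξ using fun j => (e j).2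
  have hπe : ∀ j, π (T x₀ (ξ j)) = e j := fun j => by
    rw [hξ]
    exact DFunLike.congr_fun hπ (e j)
  let M : Matrix (Fin r) (Fin r) (MvPolynomial ι K) :=
    Matrix.of fun j i => linearForm b ((e.coord i ∘ₗ π) ∘ₗ T.flip (ξ j))
  have hM : ∀ x, eval (fun i => b.repr x i) M.det =
      (Matrix.of fun j i => e.repr (π (T x (ξ j))) i).det := by
    intro x
    rw [RingHom.map_det]
    congr 1
    ext j i
    simp [M, eval_linearForm]
  refine ⟨M.det, fun h => ?_, fun x hx => ?_⟩
  · have h1 := hM x₀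
    rw [h, map_zero] at h1
    have : (Matrix.of fun j i => e.repr (π (T x₀ (ξ j))) i) = 1 := by
      ext j i
      simp [hπe, Matrix.one_apply, Finsupp.single_apply]
    rw [this, Matrix.det_one] at h1
    exact zero_ne_one h1
  · rw [hM] at hx
    have h1 := Matrix.linearIndependent_rows_iff_isUnit.2
      ((Matrix.isUnit_iff_isUnit_det _).2 hx.isUnit)
    have h2 : LinearIndependent K fun j =>
        (⟨T x (ξ j), ξ j, rfl⟩ : LinearMap.range (T x)) :=
      LinearIndependent.of_comp (LinearMap.pi (fun i => e.coord i) ∘ₗ π ∘ₗ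
        (LinearMap.range (T x)).subtype) h1
    simpa using h2.fintype_card_le_finrank

end Generic

section Representations

variable {K : Type*} [Field K] {𝔤 : Type*} [LieRing 𝔤] [LieAlgebra K 𝔤]
  {V : Type*} [AddCommGroup V] [Module K V]

theorem exists_finrank_range_eq_dimRegularOrbit [FiniteDimensional K V]
    (ρ : 𝔤 →ₗ⁅K⁆ Module.End K V) :
    ∃ x, Module.finrank K (LinearMap.range (R ρ x)) = dimRegularOrbit ρ :=
  Nat.sSup_mem (Set.range_nonempty _)
    ⟨Module.finrank K V, by rintro _ ⟨y, rfl⟩; exact Submodule.finrank_le _⟩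

theorem R_add_smul (ρ : 𝔤 →ₗ⁅K⁆ Module.End K V) (x a : V) (t : K) :
    R ρ (x + t • a) = R ρ x + t • R ρ a := by
  ext ξ
  simp [R]

end Representations

/-! ### Polynomial solutions of the transposed pencil -/

section Pencil

open Polynomial

variable {K : Type*} [Field K] {U V : Type*} [AddCommGroup U] [Module K U] [AddCommGroup V]
  [Module K V]

theorem apply_basis_of_toMatrix_eq_blockDiagonal {κ : Type*} [Fintype κ] [DecidableEq κ]
    {m n : κ → ℕ} {u : Module.Basis (Σ i, Fin (n i)) K U} {v : Module.Basis (Σ i, Fin (m i)) K V}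
    {A : U →ₗ[K] V} {M : ∀ i, Matrix (Fin (m i)) (Fin (n i)) K}
    (h : LinearMap.toMatrix u v A = Matrix.blockDiagonal' M) (j : κ) (c : Fin (n j)) :
    A (u ⟨j, c⟩) = ∑ r, M j r c • v ⟨j, r⟩ := by
  rw [← v.sum_repr (A (u ⟨j, c⟩)), Fintype.sum_sigma, Finset.sum_eq_single j]
  · refine Finset.sum_congr rfl fun r _ => ?_
    rw [← LinearMap.toMatrix_apply, h, Matrix.blockDiagonal'_apply_eq]
  · intro i _ hij
    refine Finset.sum_eq_zero fun r _ => ?_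
    rw [← LinearMap.toMatrix_apply, h, Matrix.blockDiagonal'_apply_ne _ _ _ hij, zero_smul]
  · simp

variable {A B : U →ₗ[K] V} {k : ℕ} {β : Fin k → Block K}
  {u : Module.Basis (Σ i, Fin (β i).cols) K U} {v : Module.Basis (Σ i, Fin (β i).rows) K V}

/-- `P` is a polynomial row vector killing `A + X B`; block-diagonality splits this condition into
one for each block. -/
theorem sum_mul_pencil_eq_zero
    (hA : LinearMap.toMatrix u v A = Matrix.blockDiagonal' fun i => (β i).matA)
    (hB : LinearMap.toMatrix u v B = Matrix.blockDiagonal' fun i => (β i).matB)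
    {P : V →ₗ[K] K[X]} (hP : ∀ ξ, P (A ξ) + X * P (B ξ) = 0) (j : Fin k) (c : Fin (β j).cols) :
    ∑ r, P (v ⟨j, r⟩) * (β j).pencil r c = 0 := by
  rw [← hP (u ⟨j, c⟩), apply_basis_of_toMatrix_eq_blockDiagonal hA,
    apply_basis_of_toMatrix_eq_blockDiagonal hB, map_sum, map_sum, Finset.mul_sum,
    ← Finset.sum_add_distrib]
  refine Finset.sum_congr rfl fun r _ => ?_
  rw [map_smul, map_smul, smul_eq_C_mul, smul_eq_C_mul, Block.pencil]
  ring

/-- The vertical blocks of a block-diagonal pencil. -/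
abbrev VerticalIndex (β : Fin k → Block K) : Type := {i // (β i).rowIndex.isSome}

/-- The position of the last row of a vertical block. -/
def lastRow (β : Fin k → Block K) (j : VerticalIndex β) : Σ i, Fin (β i).rows :=
  ⟨j, (β j).rowIndex.get j.2, by
    rw [Block.rows_eq_of_rowIndex_eq_some (Option.some_get j.2).symm]
    exact Nat.lt_succ_self _⟩

omit [Field K] in
theorem lastRow_injective (β : Fin k → Block K) : Function.Injective (lastRow β) :=
  fun _ _ h => Subtype.ext (congrArg Sigma.fst h)

/-- The last row of `A` in each vertical block is zero, so the corresponding coordinates are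
independent functionals vanishing on the range of `A`. -/
theorem card_verticalIndex_add_finrank_range_le
    (hA : LinearMap.toMatrix u v A = Matrix.blockDiagonal' fun i => (β i).matA) :
    Fintype.card (VerticalIndex β) + Module.finrank K (LinearMap.range A) ≤ Module.finrank K V := by
  have : FiniteDimensional K V := v.finiteDimensional_of_finite
  let φ : V →ₗ[K] VerticalIndex β → K := LinearMap.pi fun j => v.coord (lastRow β j)
  have hφ : LinearMap.range φ = ⊤ := by
    rw [LinearMap.range_eq_top]
    intro c
    refine ⟨∑ j, c j • v (lastRow β j), ?_⟩
    ext i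
    simp [φ, Finsupp.single_apply, (lastRow_injective β).eq_iff]
  have hle : LinearMap.range A ≤ LinearMap.ker φ := by
    rw [LinearMap.range_le_ker_iff]
    refine u.ext ?_
    rintro ⟨i, c⟩
    ext j
    rw [LinearMap.comp_apply, apply_basis_of_toMatrix_eq_blockDiagonal hA]
    simp only [φ, map_sum, map_smul, LinearMap.pi_apply,
      Module.Basis.coord_apply, Module.Basis.repr_self, LinearMap.zero_apply, Pi.zero_apply]
    refine Finset.sum_eq_zero fun r _ => ?_
    by_cases hr : (⟨i, r⟩ : Σ i, Fin (β i).rows) = lastRow β j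
    · obtain ⟨j, hj⟩ := j
      obtain rfl : i = j := congrArg Sigma.fst hr
      obtain rfl := eq_of_heq (Sigma.mk.inj hr).2
      rw [Block.matA_last (Option.some_get hj).symm rfl, zero_smul]
    · rw [Finsupp.single_eq_of_ne (Ne.symm hr), smul_zero]
  have h1 := LinearMap.finrank_range_add_finrank_ker φ
  rw [hφ, finrank_top, Module.finrank_fintype_fun_eq_card] at h1
  have h2 := Submodule.finrank_mono hle
  omega

/-- On each block a solution is zero or a multiple of its last entry, so the last entries detect its
value at `0`. -/
theorem eval_zero_eq_zero_of_forall_lastRow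
    (hA : LinearMap.toMatrix u v A = Matrix.blockDiagonal' fun i => (β i).matA)
    (hB : LinearMap.toMatrix u v B = Matrix.blockDiagonal' fun i => (β i).matB)
    {P : V →ₗ[K] K[X]} (hP : ∀ ξ, P (A ξ) + X * P (B ξ) = 0)
    (h0 : ∀ j, (P (v (lastRow β j))).eval 0 = 0) (x : V) : (P x).eval 0 = 0 := by
  have h1 : (Polynomial.leval 0 : K[X] →ₗ[K] K) ∘ₗ P = 0 := by
    refine v.ext ?_
    rintro ⟨i, r⟩
    have hk := sum_mul_pencil_eq_zero hA hB hP i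
    change (P (v ⟨i, r⟩)).eval 0 = 0
    cases hi : (β i).rowIndex with
    | none => rw [congrFun (Block.eq_zero_of_rowIndex_eq_none hi hk) r, Pi.zero_apply, eval_zero]
    | some η =>
      let j : VerticalIndex β := ⟨i, by rw [hi]; rfl⟩
      have hj : ((lastRow β j).2 : ℕ) = η := by simp [lastRow, j, hi]
      rw [Block.eq_pow_mul_last hi hk hj r, eval_mul]
      exact mul_eq_zero_of_right _ (h0 j)
  exact DFunLike.congr_fun h1 x

/-- The first entry on the block is `(-X)^η` times the last one. -/
theorem rowIndex_le_natDegree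
    (hA : LinearMap.toMatrix u v A = Matrix.blockDiagonal' fun i => (β i).matA)
    (hB : LinearMap.toMatrix u v B = Matrix.blockDiagonal' fun i => (β i).matB)
    {P : V →ₗ[K] K[X]} (hP : ∀ ξ, P (A ξ) + X * P (B ξ) = 0) (j : VerticalIndex β)
    (h0 : P (v (lastRow β j)) ≠ 0) :
    ∃ x, P x ≠ 0 ∧ (β j).rowIndex.get j.2 ≤ (P x).natDegree := by
  have hj := (Option.some_get j.2).symm
  have h1 : P _ = (-X) ^ ((β j).rowIndex.get j.2) * P (v (lastRow β j)) :=
    Block.eq_pow_mul_last hj (sum_mul_pencil_eq_zero hA hB hP j)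
    (s := (lastRow β j).2) rfl
    ⟨0, by rw [Block.rows_eq_of_rowIndex_eq_some hj]; exact Nat.succ_pos _⟩
  have h2 : (-X : K[X]) ^ ((β j).rowIndex.get j.2) ≠ 0 := pow_ne_zero _ (neg_ne_zero.2 X_ne_zero)
  refine ⟨_, h1 ▸ mul_ne_zero h2 h0, ?_⟩
  rw [h1, natDegree_mul h2 h0, natDegree_pow, natDegree_neg, natDegree_X, mul_one]
  exact Nat.le_add_right _ _

/-- Polynomial solutions of the transposed pencil, as many as there are vertical blocks and linearly
independent at `0`, have total degree at least the sum of the minimal row indices. -/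
theorem kVert_le_sum_of_kernel
    (hA : LinearMap.toMatrix u v A = Matrix.blockDiagonal' fun i => (β i).matA)
    (hB : LinearMap.toMatrix u v B = Matrix.blockDiagonal' fun i => (β i).matB)
    {κ : Type*} [Fintype κ] (hcard : Module.finrank K V ≤
      Fintype.card κ + Module.finrank K (LinearMap.range A))
    {P : κ → V →ₗ[K] K[X]} (hP : ∀ α ξ, P α (A ξ) + X * P α (B ξ) = 0)
    (hind : LinearIndependent K fun α => (Polynomial.leval 0 : K[X] →ₗ[K] K) ∘ₗ P α)
    {d : κ → ℕ} (hd : ∀ α x, P α x ≠ 0 → (P α x).natDegree < d α) :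
    (blocksType β).kVert ≤ ∑ α, d α := by
  classical
  have hrow : LinearIndependent K fun α j => (P α (v (lastRow β j))).eval 0 := by
    rw [Fintype.linearIndependent_iff] at hind ⊢
    intro c hc
    refine hind c (LinearMap.ext fun x => ?_)
    have h1 : ∀ y, (∑ α, c α • (Polynomial.leval 0 : K[X] →ₗ[K] K) ∘ₗ P α) y =
        ((∑ α, c α • P α) y).eval 0 := fun y => by
      simp [eval_finsetSum]
    rw [h1]
    refine eval_zero_eq_zero_of_forall_lastRow hA hB (fun ξ => ?_) (fun j => ?_) x
    · simp only [LinearMap.sum_apply, LinearMap.smul_apply, Finset.mul_sum,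
        ← Finset.sum_add_distrib, mul_smul_comm, ← smul_add, hP, smul_zero, Finset.sum_const_zero]
    · rw [← h1]
      simpa using congrFun hc j
  have hle : Fintype.card κ ≤ Fintype.card (VerticalIndex β) := by
    simpa using hrow.fintype_card_le_finrank
  have hge := card_verticalIndex_add_finrank_range_le hA
  -- `hle`, `hge` and `hcard` together force equal cardinalities.
  let e : κ ≃ VerticalIndex β := Fintype.equivOfCardEq (by omega)
  let M : Matrix κ κ K := Matrix.of fun α α' => (P α (v (lastRow β (e α')))).eval 0
  have hM : M.det ≠ 0 := by
    refine ((Matrix.isUnit_iff_isUnit_det _).1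
      (Matrix.linearIndependent_rows_iff_isUnit.1 ?_)).ne_zero
    exact hrow.map' (LinearEquiv.funCongrLeft K K e).toLinearMap (LinearEquiv.ker _)
  rw [Matrix.det_apply] at hM
  -- A nonzero determinant has a nonzero term: `σ` assigns to each block a solution whose last entry
  -- there is nonzero.
  obtain ⟨σ, -, hσ⟩ := Finset.exists_ne_zero_of_sum_ne_zero hM
  have hσ' : ∀ α, M (σ α) α ≠ 0 := fun α h => hσ <|
    (congrArg _ (Finset.prod_eq_zero (f := fun i => M (σ i) i) (Finset.mem_univ α) h)).trans (smul_zero _)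
  rw [kVert_blocksType, ← Equiv.sum_comp e, ← Equiv.sum_comp σ d]
  refine Finset.sum_le_sum fun α _ => ?_
  obtain ⟨x, hx, hx'⟩ := rowIndex_le_natDegree hA hB (hP (σ α)) (e α) fun h =>
    hσ' α (by simp [M, h])
  exact hx'.trans_lt (hd _ x hx)

end Pencil

/-! ### Differentials of invariants along a line -/

section Line

variable {K : Type*} [Field K] {𝔤 : Type*} [LieRing 𝔤] [LieAlgebra K 𝔤]
  {V : Type*} [AddCommGroup V] [Module K V] {ι : Type*} [Fintype ι]

/-- The differential of `f` along the line `x + t a`, as a polynomial in `t`. -/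
noncomputable def differentialAlong (b : Module.Basis ι K V) (f : MvPolynomial ι K) (x a : V) :
    V →ₗ[K] Polynomial K :=
  ∑ i, (b.coord i).smulRight (MvPolynomial.aeval
    (fun j => Polynomial.C (b.repr x j) + Polynomial.X * Polynomial.C (b.repr a j))
    (MvPolynomial.pderiv i f))

theorem eval_differentialAlong (b : Module.Basis ι K V) (f : MvPolynomial ι K) (x a y : V) (t : K) :
    (differentialAlong b f x a y).eval t = differential b f (x + t • a) y := by
  have h : ∀ p : MvPolynomial ι K, (MvPolynomial.aeval
      (fun j => Polynomial.C (b.repr x j) + Polynomial.X * Polynomial.C (b.repr a j)) p).eval t =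
      MvPolynomial.eval (fun j => b.repr (x + t • a) j) p := by
    intro p
    have : (Polynomial.aeval t).comp (MvPolynomial.aeval fun j => Polynomial.C (b.repr x j) +
        Polynomial.X * Polynomial.C (b.repr a j)) =
        MvPolynomial.aeval fun j => b.repr (x + t • a) j := by
      ext j
      simp
      ring
    exact DFunLike.congr_fun this p
  simp only [differentialAlong, differential, LinearMap.sum_apply, Polynomial.eval_finsetSum,
    LinearMap.smulRight_apply, Polynomial.eval_smul, h, LinearMap.smul_apply, smul_eq_mul]
  exact Finset.sum_congr rfl fun i _ => mul_comm _ _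

theorem natDegree_differentialAlong_lt (b : Module.Basis ι K V) (f : MvPolynomial ι K) (x a y : V)
    (h : differentialAlong b f x a y ≠ 0) :
    (differentialAlong b f x a y).natDegree < f.totalDegree := by
  have hterm : ∀ i, MvPolynomial.pderiv i f ≠ 0 → ((b.coord i).smulRight (MvPolynomial.aeval
      (fun j => Polynomial.C (b.repr x j) + Polynomial.X * Polynomial.C (b.repr a j))
      (MvPolynomial.pderiv i f)) y).natDegree < f.totalDegree := by
    intro i hi
    refine (Polynomial.natDegree_smul_le _ _).trans_lt
      ((natDegree_aeval_le_totalDegree _ (fun j => ?_) _).trans_lt (totalDegree_pderiv_lt hi))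
    compute_degree
  -- Zero summands have `natDegree` equal to `0`, so the strict bound needs `f` nonconstant, which
  -- `h` ensures.
  have hpos : 0 < f.totalDegree := by
    by_contra hf
    have : ∀ i, MvPolynomial.pderiv i f = 0 := fun i => by
      by_contra hi
      exact hf ((Nat.zero_le _).trans_lt (totalDegree_pderiv_lt hi))
    exact h (by simp [differentialAlong, this])
  rw [differentialAlong, LinearMap.sum_apply]
  refine (Polynomial.natDegree_sum_le _ _).trans_lt ((Finset.fold_max_lt _).2 ⟨hpos, fun i _ => ?_⟩)
  by_cases hi : MvPolynomial.pderiv i f = 0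
  · simpa [hi] using hpos
  · exact hterm i hi

/-- Invariance at `x + t • a` gives the identity for every scalar `t`, hence as polynomials over an
infinite field. -/
theorem IsInvariant.differentialAlong_kernel [Infinite K] {ρ : 𝔤 →ₗ⁅K⁆ Module.End K V}
    {b : Module.Basis ι K V} {f : MvPolynomial ι K} (hf : IsInvariant ρ b f) (x a : V) (ξ : 𝔤) :
    differentialAlong b f x a (R ρ x ξ) +
      Polynomial.X * differentialAlong b f x a (R ρ a ξ) = 0 := by
  refine Polynomial.funext fun t => ?_
  have h : differential b f (x + t • a) (R ρ (x + t • a) ξ) = 0 :=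
    DFunLike.congr_fun (hf (x + t • a)) ξ
  rw [R_add_smul, LinearMap.add_apply, LinearMap.smul_apply, map_add, map_smul] at h
  simpa [eval_differentialAlong] using h

/-- The differentials of algebraically independent polynomials are linearly independent outside of
a hypersurface. -/
theorem exists_polynomial_linearIndependent_differential [CharZero K] {κ : Type*} [Fintype κ]
    (b : Module.Basis ι K V) {f : κ → MvPolynomial ι K} (hf : AlgebraicIndependent K f) :
    ∃ p : MvPolynomial ι K, p ≠ 0 ∧ ∀ x, MvPolynomial.eval (fun i => b.repr x i) p ≠ 0 →
      LinearIndependent K fun α => differential b (f α) x := by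
  classical
  obtain ⟨p, N, hp, hN⟩ := exists_jacobian_mul_eq hf
  refine ⟨p, hp, fun x hx => Fintype.linearIndependent_iff.2 fun c hc β => ?_⟩
  -- Column `β` of the Jacobian's right inverse, evaluated at `x`, isolates the coefficient `c β`.
  have h := DFunLike.congr_fun hc (∑ i, MvPolynomial.eval (fun j => b.repr x j) (N i β) • b i)
  have hd : ∀ α, differential b (f α) x
      (∑ i, MvPolynomial.eval (fun j => b.repr x j) (N i β) • b i) =
      if α = β then MvPolynomial.eval (fun j => b.repr x j) p else 0 := by
    intro α
    have := congrArg (MvPolynomial.eval fun j => b.repr x j) (hN α β)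
    rw [apply_ite (MvPolynomial.eval fun j => b.repr x j), map_zero, map_sum] at this
    rw [← this]
    simp only [differential, LinearMap.sum_apply, LinearMap.smul_apply, Module.Basis.coord_apply,
      Module.Basis.repr_sum_self, smul_eq_mul, map_mul]
  simp only [LinearMap.sum_apply, LinearMap.smul_apply, hd, smul_eq_mul, mul_ite, mul_zero,
    Finset.sum_ite_eq', Finset.mem_univ, if_true, LinearMap.zero_apply] at h
  exact (mul_eq_zero.1 h).resolve_right hx

end Line

/-- The bound holds for every generic type, so it does not depend on which one
`jordanKroneckerInvariant` chooses. -/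
theorem IsGenericType.kVert_le_sum_totalDegree {K : Type*} [Field K] [CharZero K]
    {𝔤 : Type*} [LieRing 𝔤] [LieAlgebra K 𝔤]
    {V : Type*} [AddCommGroup V] [Module K V] [FiniteDimensional K V]
    {ρ : 𝔤 →ₗ⁅K⁆ Module.End K V} {T : AlgebraicType} (hT : IsGenericType ρ T)
    {ι : Type*} [Fintype ι] (b : Module.Basis ι K V)
    (f : Fin (codimRegularOrbit ρ) → MvPolynomial ι K)
    (hinv : ∀ α, IsInvariant ρ b (f α)) (hind : AlgebraicIndependent K f) :
    T.kVert ≤ ∑ α, (f α).totalDegree := by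
  obtain ⟨W, hW, hne, hWT⟩ := hT
  obtain ⟨a, p, hp, hpW⟩ := hW.exists_polynomial hne b
  obtain ⟨x₀, hx₀⟩ := exists_finrank_range_eq_dimRegularOrbit ρ
  let L : V →ₗ[K] 𝔤 →ₗ[K] V :=
    { toFun := R ρ
      map_add' := fun x y => by simpa using R_add_smul ρ x y 1
      map_smul' := fun c x => by ext ξ; simp [R] }
  obtain ⟨q, hq, hqR⟩ := exists_polynomial_le_finrank_range L b x₀
  obtain ⟨r, hr, hrf⟩ := exists_polynomial_linearIndependent_differential b hind
  -- One point `x` outside three hypersurfaces: generic type of the pencil, maximal rank of `R_x`,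
  -- independent differentials.
  obtain ⟨x, hx⟩ := exists_eval_ne_zero b (mul_ne_zero (mul_ne_zero hp hq) hr)
  simp only [map_mul, mul_ne_zero_iff] at hx
  obtain ⟨⟨hxp, hxq⟩, hxr⟩ := hx
  obtain ⟨k, β, ⟨u, v, hA, hB⟩, rfl⟩ := hWT _ (hpW x hxp)
  have hrank : dimRegularOrbit ρ ≤ Module.finrank K (LinearMap.range (R ρ x)) :=
    hx₀.symm.trans_le (hqR x hxq)
  refine kVert_le_sum_of_kernel hA hB (P := fun α => differentialAlong b (f α) x a) ?_
    (fun α ξ => (hinv α).differentialAlong_kernel x a ξ) ?_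
    fun α y hy => natDegree_differentialAlong_lt b (f α) x a y hy
  · rw [Fintype.card_fin, codimRegularOrbit]
    dsimp only
    omega
  · convert hrf x hxr using 2 with α
    ext y
    simpa using eval_differentialAlong b (f α) x a y 0

end JordanKronecker

theorem mainTheorem5 {K : Type*} [Field K] [IsAlgClosed K] [CharZero K]
    {𝔤 : Type*} [LieRing 𝔤] [LieAlgebra K 𝔤] [FiniteDimensional K 𝔤]
    {V : Type*} [AddCommGroup V] [Module K V] [FiniteDimensional K V]
    (ρ : 𝔤 →ₗ⁅K⁆ Module.End K V)
    {ι : Type*} [Fintype ι] (b : Module.Basis ι K V)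
    (f : Fin (JordanKronecker.codimRegularOrbit ρ) → MvPolynomial ι K)
    (hinv : ∀ α, JordanKronecker.IsInvariant ρ b (f α))
    (hind : AlgebraicIndependent K f) :
    JordanKronecker.totalKroneckerVIndex ρ ≤ ∑ α, (f α).totalDegree := by
  rw [JordanKronecker.totalKroneckerVIndex, JordanKronecker.jordanKroneckerInvariant]
  split_ifs with h
  · exact h.choose_spec.kVert_le_sum_totalDegree b f hinv hind
  -- The default type has no row indices, so its index is `0`.
  · simp [JordanKronecker.AlgebraicType.kVert]
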